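/- Let $1\le p<\infty$ and $1\le r<\infty$, let $\beta=(\beta_n)$ be a bounded sequence of complex numbers, and let $\mathfrak M_\beta\colon\ell^p\to\ell^p$, $\mathfrak M_\beta\big((a_n)\big)=(\beta_na_n)$, be the diagonal multiplier on the complex sequence space $\ell^p$. For a bounded operator $T\colon X\to Y$ between Banach spaces, let $\pi_r(T)\in[0,\infty]$ be the least constant $C\ge0$ such that $$\Big(\sum_{j=1}^n\|Tx_j\|^r\Big)^{1/r}\le C\sup_{x^*\in B_{X^*}}\Big(\sum_{j=1}^n|\langle x^*,x_j\rangle|^r\Big)^{1/r}$$ for every finite sequence $x_1,\dots,x_n$ in $X$ ($\pi_r(T)=\infty$ if there is no such $C$, i.e. if $T$ is not $r$-summing). For $1\le q<\infty$ let $\|\beta\|_q=\big(\sum_n|\beta_n|^q\big)^{1/q}\in[0,\infty]$, and for $p\geq 2$ let $p'=p/(p-1)$. Write $A\approx B$ if $c\,B\le A\le c'\,B$ for some constants $c,c'\in(0,\infty)$ that depend only on $p$ and $r$, not on $\beta$ (so that $A$ and $B$ are finite simultaneously). Then: 1. for $1\le p\le2$ and every $r\ge1$, $\pi_r(\mathfrak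 M_\beta)\approx\|\beta\|_2$; 2. for $p\ge2$ and $1\le r\le p'$, $\pi_r(\mathfrak M_\beta)\approx\|\beta\|_{p'}$; 3. for $p\ge2$ and $p'\le r\le p$, $\pi_r(\mathfrak M_\beta)=\|\beta\|_r$; 4. for $p\ge2$ and $r\ge p$, $\pi_r(\mathfrak M_\beta)\approx\|\beta\|_p$. -/

import Mathlib

open scoped ENNReal NNReal lp

/-- `C` is an admissible constant in the definition of an `r`-summing operator `T : X → Y`:
for every finite sequence `x₁, …, xₙ` in `X`,
`(∑ ‖T xⱼ‖ ^ r) ^ (1 / r) ≤ C * sup_{‖φ‖ ≤ 1} (∑ |φ xⱼ| ^ r) ^ (1 / r)`,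
the supremum being over the closed unit ball of the dual of `X`. -/
def IsSummingConstant {X Y : Type*} [NormedAddCommGroup X] [NormedSpace ℂ X]
    [NormedAddCommGroup Y] [NormedSpace ℂ Y] (r : ℝ) (T : X →L[ℂ] Y) (C : ℝ≥0) : Prop :=
  ∀ (n : ℕ) (x : Fin n → X),
    (∑ j, ‖T (x j)‖ₑ ^ r) ^ (1 / r) ≤
      (C : ℝ≥0∞) * ⨆ (φ : StrongDual ℂ X) (_ : ‖φ‖ ≤ 1), (∑ j, ‖φ (x j)‖ₑ ^ r) ^ (1 / r)

/-- The `r`-summing norm `π_r(T)`: the least admissible constant, and `∞` if there is none,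
that is, if `T` is not `r`-summing. -/
noncomputable def summingNorm {X Y : Type*} [NormedAddCommGroup X] [NormedSpace ℂ X]
    [NormedAddCommGroup Y] [NormedSpace ℂ Y] (r : ℝ) (T : X →L[ℂ] Y) : ℝ≥0∞ :=
  ⨅ (C : ℝ≥0) (_ : IsSummingConstant r T C), (C : ℝ≥0∞)

/-- The multiplier operator `(aₙ) ↦ (βₙ aₙ)` on `ℓ^p`, for a bounded sequence `β`. -/
noncomputable def multiplier (p : ℝ≥0∞) [Fact (1 ≤ p)] (β : ℓ^∞(ℕ, ℂ)) :
    ℓ^p(ℕ, ℂ) →L[ℂ] ℓ^p(ℕ, ℂ) :=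
  lp.mapCLM p (fun n => β n • ContinuousLinearMap.id ℂ ℂ) (norm_nonneg β) fun n => by
    simpa [norm_smul] using lp.norm_apply_le_norm ENNReal.top_ne_zero β n

theorem multiplier_apply (p : ℝ≥0∞) [Fact (1 ≤ p)] (β : ℓ^∞(ℕ, ℂ)) (a : ℓ^p(ℕ, ℂ)) (n : ℕ) :
    multiplier p β a n = β n * a n := by
  simp [multiplier]

/-- `𝔐_β eₙ = βₙ eₙ` on the canonical unit vectors. -/
theorem multiplier_single (p : ℝ≥0∞) [Fact (1 ≤ p)] (β : ℓ^∞(ℕ, ℂ)) (n : ℕ) :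
    multiplier p β (lp.single p n (1 : ℂ)) = β n • lp.single p n (1 : ℂ) := by
  ext m
  rw [multiplier_apply]
  by_cases h : m = n
  · subst h; simp
  · simp [h]

/-- `‖β‖_q = (∑ |βₙ| ^ q) ^ (1 / q)`, with value `∞` if the series diverges. -/
noncomputable def seqNorm (q : ℝ) (β : ℕ → ℂ) : ℝ≥0∞ :=
  (∑' n, ‖β n‖ₑ ^ q) ^ (1 / q)

/-! Everything reduces to finite sections, where two averages over signs do the work. Lower bounds:
test the summing inequality on all vectors `∑ ± aₙ eₙ`. Their images under the multiplier share one
norm, while a functional with coefficients `cₙ` turns them into Rademacher sums, which Khinchine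
controls by the `ℓ²` norm of `(aₙ cₙ)` (`IsSummingConstant.norm_multiplier_le`). For `p ≤ 2` take
`aₙ = |βₙ|^(2/p-1)`; for `p ≥ 2` take `aₙ = 1`, which yields `‖β‖_p` for every `r`. Testing on the
`eₙ` themselves yields `‖β‖_r` once `r ≥ p'`. Upper bounds: for `r = 1`, average the functionals `∑
± aₙ eₙ*` and apply the `L¹` Khinchine inequality (`sum_sqrt_le_of_forall_dual`). For `r ≤ p`,
exchanging sums and using only coordinate functionals gives `‖β‖_r` with constant 1. Finally,
summing constants persist when the exponent increases (`IsSummingConstant.mono_exponent`), which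
carries the bounds at `1`, `p'` and `p` to the remaining `r`. -/

theorem sum_rpow_mul_rpow_le {ι : Type*} (s : Finset ι) {u v : ι → ℝ} (hu : ∀ i ∈ s, 0 ≤ u i)
    (hv : ∀ i ∈ s, 0 ≤ v i) {a b : ℝ} (ha : 0 ≤ a) (hb : 0 ≤ b) (hab : a + b = 1) :
    ∑ i ∈ s, u i ^ a * v i ^ b ≤ (∑ i ∈ s, u i) ^ a * (∑ i ∈ s, v i) ^ b := by
  rcases ha.eq_or_lt with rfl | ha
  · obtain rfl : b = 1 := by linarith
    simp
  rcases hb.eq_or_lt with rfl | hb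
  · obtain rfl : a = 1 := by linarith
    simp
  have h := Real.inner_le_Lp_mul_Lq_of_nonneg s (Real.HolderConjugate.inv_inv ha hb hab)
    (fun i hi => Real.rpow_nonneg (hu i hi) a) (fun i hi => Real.rpow_nonneg (hv i hi) b)
  rw [Finset.sum_congr rfl fun i hi => Real.rpow_rpow_inv (hu i hi) ha.ne',
    Finset.sum_congr rfl fun i hi => Real.rpow_rpow_inv (hv i hi) hb.ne'] at h
  simpa using h

theorem sum_rpow_le_rpow_sum {ι : Type*} (s : Finset ι) {u : ι → ℝ} (hu : ∀ i ∈ s, 0 ≤ u i)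
    {θ : ℝ} (hθ : 1 ≤ θ) : ∑ i ∈ s, u i ^ θ ≤ (∑ i ∈ s, u i) ^ θ := by
  have key : ∀ x : ℝ, 0 ≤ x → x ^ θ = x * x ^ (θ - 1) := fun x hx => by
    rw [← Real.rpow_one_add' hx (by linarith)]; congr 1; ring
  rw [key _ (Finset.sum_nonneg hu), Finset.sum_mul]
  refine Finset.sum_le_sum fun i hi => ?_
  rw [key _ (hu i hi)]
  exact mul_le_mul_of_nonneg_left (Real.rpow_le_rpow (hu i hi)
    (Finset.single_le_sum hu hi) (by linarith)) (hu i hi)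

/-! ### Khinchine inequalities, by counting over sign patterns. -/

/-- The sum of `± c n` over `n ∈ s`, with sign `+` exactly for `n ∈ A`. -/
def signedSum {E : Type*} [AddCommGroup E] (s A : Finset ℕ) (c : ℕ → E) : E :=
  ∑ n ∈ s, if n ∈ A then c n else -c n

theorem sum_powerset_insert_signedSum {E : Type*} [AddCommGroup E] {s : Finset ℕ} {a : ℕ}
    (ha : a ∉ s) (c : ℕ → E) (F : E → ℝ) :
    ∑ A ∈ (insert a s).powerset, F (signedSum (insert a s) A c) =
      ∑ A ∈ s.powerset, (F (signedSum s A c - c a) + F (signedSum s A c + c a)) := by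
  rw [Finset.sum_powerset_insert ha, Finset.sum_add_distrib]
  congr 1 <;> refine Finset.sum_congr rfl fun A hA => ?_
  · have : a ∉ A := fun h => ha (Finset.mem_powerset.1 hA h)
    rw [signedSum, Finset.sum_insert ha, if_neg this, signedSum, neg_add_eq_sub]
  · rw [signedSum, Finset.sum_insert ha, if_pos (Finset.mem_insert_self a A), signedSum, add_comm]
    congr 2
    refine Finset.sum_congr rfl fun n hn => ?_
    have : n ≠ a := fun h => ha (h ▸ hn)
    simp [this]

theorem map_signedSum {E F : Type*} [AddCommGroup E] [AddCommGroup F] (f : E →+ F)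
    (s A : Finset ℕ) (c : ℕ → E) : f (signedSum s A c) = signedSum s A (fun n => f (c n)) := by
  simp only [signedSum, map_sum]
  exact Finset.sum_congr rfl fun n _ => by split_ifs <;> simp

/-- Subgaussian bound: each new sign contributes a factor `2 cosh c ≤ 2 exp (c² / 2)`. -/
theorem sum_exp_signedSum_le (s : Finset ℕ) (c : ℕ → ℝ) :
    ∑ A ∈ s.powerset, Real.exp (signedSum s A c) ≤
      2 ^ s.card * Real.exp ((∑ n ∈ s, c n ^ 2) / 2) := by
  induction s using Finset.induction_on with
  | empty => simp [signedSum]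
  | insert a s ha ih =>
    rw [sum_powerset_insert_signedSum ha, Finset.card_insert_of_notMem ha, Finset.sum_insert ha,
      add_div, Real.exp_add]
    have h : ∀ x : ℝ, Real.exp (x - c a) + Real.exp (x + c a) =
        2 * Real.cosh (c a) * Real.exp x := fun x => by
      rw [Real.cosh_eq, sub_eq_add_neg, Real.exp_add, Real.exp_add]; ring
    simp only [h, ← Finset.mul_sum]
    calc 2 * Real.cosh (c a) * ∑ A ∈ s.powerset, Real.exp (signedSum s A c)
        ≤ 2 * Real.exp (c a ^ 2 / 2) * (2 ^ s.card * Real.exp ((∑ n ∈ s, c n ^ 2) / 2)) := by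
          gcongr
          exact Real.cosh_le_exp_half_sq _
      _ = _ := by ring

theorem sum_exp_abs_signedSum_le (s : Finset ℕ) (c : ℕ → ℝ) :
    ∑ A ∈ s.powerset, Real.exp |signedSum s A c| ≤
      2 * (2 ^ s.card * Real.exp ((∑ n ∈ s, c n ^ 2) / 2)) := by
  have h1 := sum_exp_signedSum_le s c
  have h2 := sum_exp_signedSum_le s (fun n => -c n)
  have h3 : ∀ A, signedSum s A (fun n => -c n) = -signedSum s A c := fun A =>
    (map_signedSum (negAddMonoidHom : ℝ →+ ℝ) s A c).symm
  simp only [h3, neg_sq] at h2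
  calc _ ≤ ∑ A ∈ s.powerset, (Real.exp (signedSum s A c) + Real.exp (-signedSum s A c)) := by
        refine Finset.sum_le_sum fun A _ => ?_
        rcases abs_cases (signedSum s A c) with ⟨h, -⟩ | ⟨h, -⟩ <;> rw [h] <;>
          linarith [Real.exp_pos (signedSum s A c), Real.exp_pos (-signedSum s A c)]
    _ ≤ _ := by rw [Finset.sum_add_distrib]; linarith

/-- Orthogonality of signs, obtained by adding one term at a time through the parallelogram law. -/
theorem sum_norm_sq_signedSum (s : Finset ℕ) (c : ℕ → ℂ) :
    ∑ A ∈ s.powerset, ‖signedSum s A c‖ ^ 2 = 2 ^ s.card * ∑ n ∈ s, ‖c n‖ ^ 2 := by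
  induction s using Finset.induction_on with
  | empty => simp [signedSum]
  | insert a s ha ih =>
    rw [sum_powerset_insert_signedSum ha c (fun z => ‖z‖ ^ 2), Finset.card_insert_of_notMem ha,
      Finset.sum_insert ha]
    have h : ∀ z : ℂ, ‖z - c a‖ ^ 2 + ‖z + c a‖ ^ 2 = 2 * ‖z‖ ^ 2 + 2 * ‖c a‖ ^ 2 := fun z => by
      have := parallelogram_law_with_norm ℝ z (c a)
      linarith
    simp only [h, Finset.sum_add_distrib, ← Finset.mul_sum, ih, Finset.sum_const,
      Finset.card_powerset, nsmul_eq_mul]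
    push_cast
    ring

theorem sum_exp_norm_signedSum_le (s : Finset ℕ) (c : ℕ → ℂ) (hc : ∑ n ∈ s, ‖c n‖ ^ 2 ≤ 1) :
    ∑ A ∈ s.powerset, Real.exp ‖signedSum s A c‖ ≤ 2 ^ s.card * (2 * Real.exp 2) := by
  have key : ∀ d : ℕ → ℝ, (∀ n, |d n| ≤ 2 * ‖c n‖) →
      ∑ A ∈ s.powerset, Real.exp |signedSum s A d| ≤ 2 ^ s.card * (2 * Real.exp 2) := by
    intro d hd
    refine (sum_exp_abs_signedSum_le s d).trans ?_
    have : ∑ n ∈ s, d n ^ 2 ≤ 4 * ∑ n ∈ s, ‖c n‖ ^ 2 := by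
      rw [Finset.mul_sum]
      refine Finset.sum_le_sum fun n _ => ?_
      nlinarith [sq_abs (d n), hd n, abs_nonneg (d n)]
    have : Real.exp ((∑ n ∈ s, d n ^ 2) / 2) ≤ Real.exp 2 := Real.exp_le_exp.2 (by linarith)
    nlinarith [show (0 : ℝ) < 2 ^ s.card by positivity]
  have h1 := key (fun n => 2 * (c n).re) fun n => by
    rw [abs_mul, abs_two]; gcongr; exact Complex.abs_re_le_norm _
  have h2 := key (fun n => 2 * (c n).im) fun n => by
    rw [abs_mul, abs_two]; gcongr; exact Complex.abs_im_le_norm _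
  have e1 : ∀ A, signedSum s A (fun n => 2 * (c n).re) = 2 * (signedSum s A c).re := fun A =>
    (map_signedSum ((AddMonoidHom.mulLeft (2 : ℝ)).comp Complex.reAddGroupHom) s A c).symm
  have e2 : ∀ A, signedSum s A (fun n => 2 * (c n).im) = 2 * (signedSum s A c).im := fun A =>
    (map_signedSum ((AddMonoidHom.mulLeft (2 : ℝ)).comp Complex.imAddGroupHom) s A c).symm
  simp only [e1, e2, abs_mul, abs_two] at h1 h2
  -- Real and imaginary parts are decoupled by `exp (x + y) ≤ (exp (2x) + exp (2y)) / 2`; this is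
  -- why both were doubled above.
  calc _ ≤ ∑ A ∈ s.powerset, (Real.exp (2 * |(signedSum s A c).re|) +
          Real.exp (2 * |(signedSum s A c).im|)) / 2 := by
        refine Finset.sum_le_sum fun A _ => ?_
        have := Complex.norm_le_abs_re_add_abs_im (signedSum s A c)
        refine (Real.exp_le_exp.2 this).trans ?_
        rw [Real.exp_add, two_mul, two_mul, Real.exp_add, Real.exp_add]
        nlinarith [sq_nonneg (Real.exp |(signedSum s A c).re| - Real.exp |(signedSum s A c).im|)]
    _ ≤ _ := by
        rw [← Finset.sum_div, Finset.sum_add_distrib]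
        linarith

theorem rpow_le_rpow_mul_exp {r t : ℝ} (hr : 0 < r) (ht : 0 ≤ t) :
    t ^ r ≤ r ^ r * Real.exp t := by
  have h : t ≤ r * Real.exp (t / r) := by
    have := Real.add_one_le_exp (t / r)
    calc t = r * (t / r) := by field_simp
      _ ≤ _ := by gcongr; linarith
  calc t ^ r ≤ (r * Real.exp (t / r)) ^ r := Real.rpow_le_rpow ht h hr.le
    _ = r ^ r * Real.exp t := by
      rw [Real.mul_rpow hr.le (Real.exp_pos _).le, ← Real.exp_mul]
      congr 2
      field_simp

theorem signedSum_smul (s A : Finset ℕ) (k : ℂ) (c : ℕ → ℂ) :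
    signedSum s A (fun n => k * c n) = k * signedSum s A c :=
  (map_signedSum (AddMonoidHom.mulLeft k) s A c).symm

/-- The constant in the upper Khinchine inequality below. -/
noncomputable def khinchineConst (r : ℝ) : ℝ := r ^ r * (2 * Real.exp 2)

theorem khinchineConst_pos {r : ℝ} (hr : 0 < r) : 0 < khinchineConst r := by
  have := Real.exp_pos 2
  have := Real.rpow_pos_of_pos hr r
  unfold khinchineConst
  positivity

/-- Scaling to `σ = 1` reduces all moments to the exponential one. Only an upper bound `σ` for the
`ℓ²` norm is needed, so one `σ` serves a whole dual ball. -/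
theorem sum_norm_rpow_signedSum_le {r : ℝ} (hr : 0 < r) (s : Finset ℕ) (c : ℕ → ℂ) {σ : ℝ}
    (hσ : 0 ≤ σ) (hc : ∑ n ∈ s, ‖c n‖ ^ 2 ≤ σ ^ 2) :
    ∑ A ∈ s.powerset, ‖signedSum s A c‖ ^ r ≤ 2 ^ s.card * (khinchineConst r * σ ^ r) := by
  rcases hσ.eq_or_lt with rfl | hσ
  · have h0 : ∀ n ∈ s, c n = 0 := by
      have := (Finset.sum_eq_zero_iff_of_nonneg (fun n _ => sq_nonneg ‖c n‖)).1
        (le_antisymm (hc.trans (by simp)) (Finset.sum_nonneg fun n _ => sq_nonneg ‖c n‖))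
      intro n hn
      simpa using this n hn
    have : ∀ A, signedSum s A c = 0 := fun A =>
      Finset.sum_eq_zero fun n hn => by simp [h0 n hn]
    simp [this, Real.zero_rpow hr.ne']
  have h1 : ∑ n ∈ s, ‖(σ : ℂ)⁻¹ * c n‖ ^ 2 ≤ 1 := by
    simp only [norm_mul, mul_pow, ← Finset.mul_sum, norm_inv, Complex.norm_real, Real.norm_eq_abs,
      abs_of_pos hσ, inv_pow]
    rwa [inv_mul_le_iff₀ (by positivity), mul_one]
  have h2 := sum_exp_norm_signedSum_le s _ h1
  have hσr : 0 < σ ^ r := Real.rpow_pos_of_pos hσ r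
  have hrr : 0 < r ^ r := Real.rpow_pos_of_pos hr r
  have h3 : ∀ A, ‖signedSum s A c‖ ^ r ≤
      σ ^ r * (r ^ r * Real.exp ‖signedSum s A (fun n => (σ : ℂ)⁻¹ * c n)‖) := fun A => by
    have : ‖signedSum s A c‖ = σ * ‖signedSum s A (fun n => (σ : ℂ)⁻¹ * c n)‖ := by
      rw [signedSum_smul, norm_mul, norm_inv, Complex.norm_real, Real.norm_eq_abs, abs_of_pos hσ]
      field_simp
    rw [this, Real.mul_rpow hσ.le (norm_nonneg _)]
    gcongr
    exact rpow_le_rpow_mul_exp hr (norm_nonneg _)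
  refine (Finset.sum_le_sum fun A _ => h3 A).trans ?_
  rw [← Finset.mul_sum, ← Finset.mul_sum]
  calc _ ≤ σ ^ r * (r ^ r * (2 ^ s.card * (2 * Real.exp 2))) := by gcongr
    _ = _ := by unfold khinchineConst; ring

/-- The constant in the lower Khinchine inequality below. -/
noncomputable def khinchineLowerConst : ℝ := 2 * √(2 * khinchineConst 4)

theorem khinchineLowerConst_pos : 0 < khinchineLowerConst := by
  have := khinchineConst_pos (r := 4) (by norm_num)
  unfold khinchineLowerConst
  positivity

theorem sqrt_sum_sq_le_sum_norm_signedSum (s : Finset ℕ) (c : ℕ → ℂ) :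
    2 ^ s.card * √(∑ n ∈ s, ‖c n‖ ^ 2) ≤
      khinchineLowerConst * ∑ A ∈ s.powerset, ‖signedSum s A c‖ := by
  set σ := √(∑ n ∈ s, ‖c n‖ ^ 2) with hσdef
  have hsq : σ ^ 2 = ∑ n ∈ s, ‖c n‖ ^ 2 := Real.sq_sqrt (Finset.sum_nonneg fun n _ => by positivity)
  have hnn : 0 ≤ ∑ A ∈ s.powerset, ‖signedSum s A c‖ := Finset.sum_nonneg fun _ _ => norm_nonneg _
  rcases (Real.sqrt_nonneg _ : 0 ≤ σ).eq_or_lt with h0 | hσ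
  · rw [show σ = 0 from h0.symm, mul_zero]
    exact mul_nonneg khinchineLowerConst_pos.le hnn
  have h2 := sum_norm_sq_signedSum s c
  have h4 := sum_norm_rpow_signedSum_le (r := 4) (by norm_num) s c hσ.le hsq.ge
  have hK := khinchineConst_pos (r := 4) (by norm_num)
  set K := khinchineConst 4
  set l := √(2 * K) with hl
  have hlsq : l ^ 2 = 2 * K := Real.sq_sqrt (by positivity)
  have hlpos : 0 < l := Real.sqrt_pos.2 (by positivity)
  -- Truncation at `l σ`: with `l² = 2K`, the fourth moment accounts for at most half of the second,
  -- so the first moment must carry the other half.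
  have hpt : ∀ t : ℝ, 0 ≤ t → t ^ 2 ≤ l * σ * t + t ^ 4 / (2 * K * σ ^ 2) := by
    intro t ht
    rcases le_total t (l * σ) with h | h
    · have : 0 ≤ t ^ 4 / (2 * K * σ ^ 2) := by positivity
      nlinarith
    · have h' : 2 * K * σ ^ 2 ≤ t ^ 2 := by
        rw [← hlsq, ← mul_pow]; gcongr
      have : t ^ 2 ≤ t ^ 4 / (2 * K * σ ^ 2) := by
        rw [le_div_iff₀ (by positivity)]
        nlinarith [sq_nonneg t]
      have : 0 ≤ l * σ * t := by positivity
      linarith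
  have hsum := Finset.sum_le_sum fun A (_ : A ∈ s.powerset) =>
    hpt ‖signedSum s A c‖ (norm_nonneg _)
  rw [h2, Finset.sum_add_distrib, ← Finset.mul_sum, ← Finset.sum_div, ← hsq] at hsum
  have e4 : ∀ x : ℝ, x ^ (4 : ℝ) = x ^ 4 := fun x => by
    rw [← Real.rpow_natCast]; norm_num
  simp only [e4] at h4
  have h5 : (∑ A ∈ s.powerset, ‖signedSum s A c‖ ^ 4) / (2 * K * σ ^ 2) ≤
      2 ^ s.card * σ ^ 2 / 2 := by
    rw [div_le_iff₀ (by positivity)]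
    refine h4.trans (le_of_eq ?_)
    ring
  have h6 : (2 ^ s.card * σ) * σ ≤ (2 * l * ∑ A ∈ s.powerset, ‖signedSum s A c‖) * σ := by
    nlinarith
  exact le_of_mul_le_mul_right h6 hσ

/-! ### Summing constants in real-valued form, and their dependence on the exponent. -/

section Summing

variable {X Y : Type*} [NormedAddCommGroup X] [NormedSpace ℂ X] [NormedAddCommGroup Y]
  [NormedSpace ℂ Y] {r s : ℝ} {T : X →L[ℂ] Y} {C : ℝ≥0}

theorem sum_enorm_rpow_eq_ofReal {ι E : Type*} [NormedAddCommGroup E] (u : Finset ι) (v : ι → E)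
    (hr : 0 < r) : ∑ j ∈ u, ‖v j‖ₑ ^ r = ENNReal.ofReal (∑ j ∈ u, ‖v j‖ ^ r) := by
  rw [ENNReal.ofReal_sum_of_nonneg fun j _ => by positivity]
  exact Finset.sum_congr rfl fun j _ => by
    rw [← ofReal_norm, ENNReal.ofReal_rpow_of_nonneg (norm_nonneg _) hr.le]

theorem sum_enorm_rpow_rpow_le_iff {ι E : Type*} [NormedAddCommGroup E] (u : Finset ι) (v : ι → E)
    (hr : 0 < r) {W : ℝ} (hW : 0 ≤ W) :
    (∑ j ∈ u, ‖v j‖ₑ ^ r) ^ (1 / r) ≤ ENNReal.ofReal W ↔ ∑ j ∈ u, ‖v j‖ ^ r ≤ W ^ r := by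
  rw [one_div, ENNReal.rpow_inv_le_iff hr, sum_enorm_rpow_eq_ofReal u v hr,
    ENNReal.ofReal_rpow_of_nonneg hW hr.le, ENNReal.ofReal_le_ofReal_iff (by positivity)]

theorem IsSummingConstant.sum_norm_rpow_le (h : IsSummingConstant r T C) (hr : 0 < r)
    {ι : Type*} [Fintype ι] (x : ι → X) {W : ℝ} (hW : 0 ≤ W)
    (hx : ∀ φ : StrongDual ℂ X, ‖φ‖ ≤ 1 → ∑ j, ‖φ (x j)‖ ^ r ≤ W ^ r) :
    ∑ j, ‖T (x j)‖ ^ r ≤ (C * W) ^ r := by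
  let e := Fintype.equivFin ι
  have h1 := h _ (x ∘ e.symm)
  have h2 : ⨆ (φ : StrongDual ℂ X) (_ : ‖φ‖ ≤ 1),
      (∑ j, ‖φ ((x ∘ e.symm) j)‖ₑ ^ r) ^ (1 / r) ≤ ENNReal.ofReal W := by
    refine iSup₂_le fun φ hφ => (sum_enorm_rpow_rpow_le_iff _ _ hr hW).2 ?_
    exact (e.symm.sum_comp fun j => ‖φ (x j)‖ ^ r).trans_le (hx φ hφ)
  have h3 : (C : ℝ≥0∞) * ENNReal.ofReal W = ENNReal.ofReal (C * W) := by
    rw [ENNReal.ofReal_mul C.coe_nonneg, ENNReal.ofReal_coe_nnreal]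
  have h4 := h1.trans (mul_le_mul_right h2 (C : ℝ≥0∞))
  rw [h3, sum_enorm_rpow_rpow_le_iff _ _ hr (by positivity)] at h4
  exact (e.symm.sum_comp fun j => ‖T (x j)‖ ^ r).symm.trans_le h4

theorem isSummingConstant_of_forall (hr : 0 < r)
    (h : ∀ (n : ℕ) (x : Fin n → X) (W : ℝ), 0 ≤ W →
      (∀ φ : StrongDual ℂ X, ‖φ‖ ≤ 1 → ∑ j, ‖φ (x j)‖ ^ r ≤ W ^ r) →
      ∑ j, ‖T (x j)‖ ^ r ≤ (C * W) ^ r) :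
    IsSummingConstant r T C := by
  intro n x
  set S := ⨆ (φ : StrongDual ℂ X) (_ : ‖φ‖ ≤ 1), (∑ j, ‖φ (x j)‖ₑ ^ r) ^ (1 / r) with hS
  -- The supremum is finite because `|φ (x j)| ≤ ‖x j‖`, so it can itself serve as the real bound
  -- `W`.
  have hfin : S ≤ ENNReal.ofReal ((∑ j, ‖x j‖ ^ r) ^ (1 / r)) := by
    refine iSup₂_le fun φ hφ => (sum_enorm_rpow_rpow_le_iff _ _ hr (by positivity)).2 ?_
    rw [one_div, Real.rpow_inv_rpow (by positivity) hr.ne']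
    gcongr with j
    exact φ.le_of_opNorm_le_of_le hφ le_rfl |>.trans_eq (one_mul _)
  have hS' : S = ENNReal.ofReal S.toReal :=
    (ENNReal.ofReal_toReal (hfin.trans_lt ENNReal.ofReal_lt_top).ne).symm
  have h3 : (C : ℝ≥0∞) * ENNReal.ofReal S.toReal = ENNReal.ofReal (C * S.toReal) := by
    rw [ENNReal.ofReal_mul C.coe_nonneg, ENNReal.ofReal_coe_nnreal]
  rw [hS', h3, sum_enorm_rpow_rpow_le_iff _ _ hr (by positivity)]
  refine h n x _ ENNReal.toReal_nonneg fun φ hφ => ?_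
  rw [← sum_enorm_rpow_rpow_le_iff _ _ hr ENNReal.toReal_nonneg, ← hS', hS]
  exact le_iSup₂ (f := fun (φ : StrongDual ℂ X) (_ : ‖φ‖ ≤ 1) =>
    (∑ j, ‖φ (x j)‖ₑ ^ r) ^ (1 / r)) φ hφ

/-- Rescale `x j` by `‖T (x j)‖^(s/r-1)`: the strong `r`-sum becomes the strong `s`-sum `A`, while
Hölder bounds the weak `r`-sum by `A^(1-r/s) W^r`. Cancelling that power of `A` leaves the claim. -/
theorem IsSummingConstant.mono_exponent (h : IsSummingConstant r T C) (hr : 0 < r) (hrs : r ≤ s) :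
    IsSummingConstant s T C := by
  have hs : 0 < s := hr.trans_le hrs
  refine isSummingConstant_of_forall hs fun n x W hW hx => ?_
  set A := ∑ j, ‖T (x j)‖ ^ s with hA
  have hA0 : 0 ≤ A := by positivity
  rcases hA0.eq_or_lt with h0 | hA0
  · rw [← h0]; positivity
  have hθ : 0 ≤ 1 - r / s := sub_nonneg.2 ((div_le_one hs).2 hrs)
  have e1 : ∀ t : ℝ, 0 ≤ t → (t ^ (s / r - 1)) ^ r = (t ^ s) ^ (1 - r / s) := fun t ht => by
    rw [← Real.rpow_mul ht, ← Real.rpow_mul ht]; congr 1; field_simp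
  have key := h.sum_norm_rpow_le hr
    (fun j => ((‖T (x j)‖ ^ (s / r - 1) : ℝ) : ℂ) • x j) (W := A ^ ((1 - r / s) / r) * W)
    (by positivity) fun φ hφ => by
      have e2 : ∀ j, ‖φ (((‖T (x j)‖ ^ (s / r - 1) : ℝ) : ℂ) • x j)‖ ^ r =
          (‖T (x j)‖ ^ s) ^ (1 - r / s) * (‖φ (x j)‖ ^ s) ^ (r / s) := fun j => by
        rw [map_smul, norm_smul, Complex.norm_real, Real.norm_of_nonneg (by positivity),
          Real.mul_rpow (by positivity) (by positivity), e1 _ (norm_nonneg _),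
          ← Real.rpow_mul (norm_nonneg (φ (x j)))]
        congr 2
        field_simp
      simp only [e2]
      refine (sum_rpow_mul_rpow_le _ (fun j _ => by positivity) (fun j _ => by positivity) hθ
        (by positivity) (by ring)).trans ?_
      rw [Real.mul_rpow (by positivity) hW, ← Real.rpow_mul hA0.le, div_mul_cancel₀ _ hr.ne']
      gcongr
      calc _ ≤ (W ^ s) ^ (r / s) := by gcongr; exact hx φ hφ
        _ = _ := by rw [← Real.rpow_mul hW]; congr 1; field_simp
  have e3 : ∀ j, ‖T (((‖T (x j)‖ ^ (s / r - 1) : ℝ) : ℂ) • x j)‖ ^ r = ‖T (x j)‖ ^ s := fun j => by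
    rw [map_smul, norm_smul, Complex.norm_real, Real.norm_of_nonneg (by positivity),
      ← Real.rpow_add_one' (norm_nonneg _) (by rw [sub_add_cancel]; positivity),
      ← Real.rpow_mul (norm_nonneg _)]
    congr 1
    field_simp
    ring
  simp only [e3, ← hA] at key
  rw [mul_left_comm, Real.mul_rpow (by positivity) (by positivity), ← Real.rpow_mul hA0.le,
    div_mul_cancel₀ _ hr.ne'] at key
  have e4 : A = A ^ (1 - r / s) * A ^ (r / s) := by
    rw [← Real.rpow_add hA0, sub_add_cancel, Real.rpow_one]
  have h5 : A ^ (r / s) ≤ (C * W) ^ r := by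
    refine le_of_mul_le_mul_left ?_ (Real.rpow_pos_of_pos hA0 (1 - r / s))
    rwa [← e4]
  calc A = (A ^ (r / s)) ^ (s / r) := by
        rw [← Real.rpow_mul hA0.le, div_mul_div_cancel₀ hs.ne', div_self hr.ne', Real.rpow_one]
    _ ≤ ((C * W) ^ r) ^ (s / r) := by gcongr
    _ = _ := by rw [← Real.rpow_mul (by positivity)]; congr 1; field_simp

end Summing

theorem seqNorm_le {q : ℝ} (hq : 0 < q) {β : ℕ → ℂ} {D : ℝ≥0}
    (h : ∀ s : Finset ℕ, ∑ n ∈ s, ‖β n‖ ^ q ≤ (D : ℝ) ^ q) : seqNorm q β ≤ D := by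
  rw [seqNorm, one_div, ENNReal.rpow_inv_le_iff hq, ENNReal.tsum_eq_iSup_sum]
  refine iSup_le fun s => ?_
  rw [← ENNReal.rpow_inv_le_iff hq, ← one_div, ← ENNReal.ofReal_coe_nnreal,
    sum_enorm_rpow_rpow_le_iff _ _ hq D.coe_nonneg]
  exact h s

theorem sum_rpow_le_of_seqNorm_le {q : ℝ} (hq : 0 < q) {β : ℕ → ℂ} {D : ℝ≥0}
    (h : seqNorm q β ≤ D) (s : Finset ℕ) : ∑ n ∈ s, ‖β n‖ ^ q ≤ (D : ℝ) ^ q := by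
  rw [← sum_enorm_rpow_rpow_le_iff _ _ hq D.coe_nonneg, ENNReal.ofReal_coe_nnreal]
  refine le_trans ?_ h
  rw [seqNorm]
  gcongr
  exact ENNReal.sum_le_tsum s

/-! ### Finite sections of `ℓ^p` and averaging over signs. -/

section Lp

variable {p : ℝ≥0} [Fact (1 ≤ (p : ℝ≥0∞))]

theorem one_le_coe_of_fact (p : ℝ≥0) [h : Fact (1 ≤ (p : ℝ≥0∞))] : (1 : ℝ) ≤ p := by
  exact_mod_cast h.out

theorem inv_mul_seqNorm_le_summingNorm {q r : ℝ} (hq : 0 < q) {β : ℓ^∞(ℕ, ℂ)} {K : ℝ≥0} (hK : 0 < K)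
    (h : ∀ C : ℝ≥0, IsSummingConstant r (multiplier p β) C →
      ∀ s : Finset ℕ, ∑ n ∈ s, ‖β n‖ ^ q ≤ ((K * C : ℝ≥0) : ℝ) ^ q) :
    (K⁻¹ : ℝ≥0) * seqNorm q β ≤ summingNorm r (multiplier p β) := by
  refine le_iInf₂ fun C hC => ?_
  have := seqNorm_le hq (h C hC)
  calc _ ≤ ((K⁻¹ : ℝ≥0) : ℝ≥0∞) * (K * C : ℝ≥0) := by gcongr
    _ = C := by rw [← ENNReal.coe_mul, inv_mul_cancel_left₀ hK.ne']

theorem summingNorm_le_mul_seqNorm {q r : ℝ} (hq : 0 < q) {β : ℓ^∞(ℕ, ℂ)} {K : ℝ≥0} (hK : 0 < K)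
    (h : ∀ D : ℝ≥0, (∀ s : Finset ℕ, ∑ n ∈ s, ‖β n‖ ^ q ≤ (D : ℝ) ^ q) →
      IsSummingConstant r (multiplier p β) (K * D)) :
    summingNorm r (multiplier p β) ≤ K * seqNorm q β := by
  rcases eq_or_ne (seqNorm q β) ⊤ with htop | htop
  · rw [htop, ENNReal.mul_top (by exact_mod_cast hK.ne')]
    exact le_top
  · lift seqNorm q β to ℝ≥0 using htop with D hD
    rw [← ENNReal.coe_mul]
    exact iInf₂_le (K * D) (h D (sum_rpow_le_of_seqNorm_le hq hD.ge))

theorem norm_sum_single_eq (s : Finset ℕ) (f : ℕ → ℂ) :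
    ‖∑ n ∈ s, (lp.single p n (f n) : ℓ^p(ℕ, ℂ))‖ = (∑ n ∈ s, ‖f n‖ ^ (p : ℝ)) ^ (1 / (p : ℝ)) := by
  have hp : (0 : ℝ) < p := zero_lt_one.trans_le (one_le_coe_of_fact p)
  have := lp.norm_sum_single (p := (p : ℝ≥0∞)) (E := fun _ : ℕ => ℂ) (by simpa using hp) f s
  rw [ENNReal.coe_toReal] at this
  rw [← this, one_div, Real.rpow_rpow_inv (norm_nonneg _) hp.ne']

theorem apply_sum_single (φ : StrongDual ℂ ℓ^p(ℕ, ℂ)) (s : Finset ℕ) (f : ℕ → ℂ) :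
    φ (∑ n ∈ s, lp.single p n (f n)) = ∑ n ∈ s, f n * φ (lp.single p n 1) := by
  rw [map_sum]
  refine Finset.sum_congr rfl fun n _ => ?_
  rw [← smul_eq_mul, ← map_smul, ← lp.single_smul, smul_eq_mul, mul_one]

/-- Rotating phases makes all terms of `φ` nonnegative. This places the coefficients in the unit
ball of the dual without naming a conjugate exponent, so `p = 1` is included. -/
theorem sum_norm_dual_mul_le (φ : StrongDual ℂ ℓ^p(ℕ, ℂ)) (hφ : ‖φ‖ ≤ 1) (s : Finset ℕ)
    (t : ℕ → ℝ) (ht : ∀ n, 0 ≤ t n) :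
    ∑ n ∈ s, ‖φ (lp.single p n 1)‖ * t n ≤ (∑ n ∈ s, t n ^ (p : ℝ)) ^ (1 / (p : ℝ)) := by
  have hp : (0 : ℝ) < p := zero_lt_one.trans_le (one_le_coe_of_fact p)
  have hu : ∀ z : ℂ, ∃ u : ℂ, ‖u‖ ≤ 1 ∧ u * z = ‖z‖ := fun z => by
    rcases eq_or_ne z 0 with rfl | hz
    · exact ⟨0, by simp⟩
    · have hz' : (‖z‖ : ℂ) ≠ 0 := by simpa using hz
      refine ⟨‖z‖ / z, ?_, div_mul_cancel₀ _ hz⟩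
      rw [norm_div, Complex.norm_real, norm_norm, div_self (norm_ne_zero_iff.2 hz)]
  choose u hu1 hu2 using fun n => hu (φ (lp.single p n 1))
  have h1 := φ.le_of_opNorm_le hφ (∑ n ∈ s, lp.single p n (u n * t n))
  rw [apply_sum_single, norm_sum_single_eq, one_mul] at h1
  have h2 : ∑ n ∈ s, u n * t n * φ (lp.single p n 1) =
      ((∑ n ∈ s, ‖φ (lp.single p n 1)‖ * t n : ℝ) : ℂ) := by
    push_cast
    refine Finset.sum_congr rfl fun n _ => ?_
    rw [← hu2 n]
    ring
  rw [h2, Complex.norm_real] at h1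
  refine (Real.le_norm_self _).trans (h1.trans ?_)
  gcongr with n
  rw [norm_mul, Complex.norm_real, Real.norm_of_nonneg (ht n)]
  exact mul_le_of_le_one_left (ht n) (hu1 n)

theorem multiplier_sum_single (β : ℓ^∞(ℕ, ℂ)) (s : Finset ℕ) (f : ℕ → ℂ) :
    multiplier p β (∑ n ∈ s, lp.single p n (f n)) = ∑ n ∈ s, lp.single p n (β n * f n) := by
  rw [map_sum]
  refine Finset.sum_congr rfl fun n _ => ?_
  have : (lp.single p n (f n) : ℓ^p(ℕ, ℂ)) = f n • lp.single p n 1 := by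
    rw [← lp.single_smul, smul_eq_mul, mul_one]
  rw [this, map_smul, multiplier_single, smul_smul, ← lp.single_smul, smul_eq_mul, mul_one,
    mul_comm]

/-- Lower bound for the summing norm, by testing on `∑ ± aₙ eₙ` over all choices of signs. -/
theorem IsSummingConstant.norm_multiplier_le {r : ℝ} (hr : 0 < r) {β : ℓ^∞(ℕ, ℂ)} {C : ℝ≥0}
    (h : IsSummingConstant r (multiplier p β) C) (s : Finset ℕ) (a : ℕ → ℝ) (ha : ∀ n, 0 ≤ a n)
    {Q : ℝ} (hQ : 0 ≤ Q)
    (hc : ∀ c : ℕ → ℝ, (∀ n, 0 ≤ c n) → (∀ t : ℕ → ℝ, (∀ n, 0 ≤ t n) →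
        ∑ n ∈ s, c n * t n ≤ (∑ n ∈ s, t n ^ (p : ℝ)) ^ (1 / (p : ℝ))) →
      ∑ n ∈ s, (a n * c n) ^ 2 ≤ Q ^ 2) :
    (∑ n ∈ s, (‖β n‖ * a n) ^ (p : ℝ)) ^ (1 / (p : ℝ)) ≤
      khinchineConst r ^ (1 / r) * Q * C := by
  have hK := khinchineConst_pos hr
  have hcard : (0 : ℝ) < 2 ^ s.card := by positivity
  set R := (∑ n ∈ s, (‖β n‖ * a n) ^ (p : ℝ)) ^ (1 / (p : ℝ)) with hR
  have hR0 : 0 ≤ R := Real.rpow_nonneg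
    (Finset.sum_nonneg fun n _ => Real.rpow_nonneg (mul_nonneg (norm_nonneg _) (ha n)) _) _
  let x : Finset ℕ → ℓ^p(ℕ, ℂ) := fun A =>
    ∑ n ∈ s, lp.single p n (if n ∈ A then (a n : ℂ) else -a n)
  have hx : ∀ A, ‖multiplier p β (x A)‖ = R := fun A => by
    rw [multiplier_sum_single, norm_sum_single_eq, hR]
    congr 1
    refine Finset.sum_congr rfl fun n _ => ?_
    rw [norm_mul]
    split_ifs <;> simp [abs_of_nonneg (ha n)]
  -- The factor `2 ^ s.card` in `W` counts the test vectors; it appears on both sides and cancels.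
  have key := h.sum_norm_rpow_le hr (fun A : s.powerset => x A)
    (W := (2 ^ s.card * khinchineConst r) ^ (1 / r) * Q) (by positivity) fun φ hφ => by
      rw [Finset.sum_coe_sort s.powerset fun A => ‖φ (x A)‖ ^ r]
      have h1 : ∀ A, φ (x A) = signedSum s A fun n => a n * φ (lp.single p n 1) := fun A => by
        rw [apply_sum_single, signedSum]
        refine Finset.sum_congr rfl fun n _ => ?_
        split_ifs <;> simp
      simp only [h1]
      refine (sum_norm_rpow_signedSum_le hr s _ hQ ?_).trans_eq ?_
      · simp only [norm_mul, Complex.norm_real, Real.norm_of_nonneg (ha _)]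
        exact hc _ (fun n => norm_nonneg _) (sum_norm_dual_mul_le φ hφ s)
      · rw [Real.mul_rpow (by positivity) hQ, one_div,
          Real.rpow_inv_rpow (by positivity) hr.ne', mul_assoc]
  rw [Finset.sum_coe_sort s.powerset fun A => ‖multiplier p β (x A)‖ ^ r] at key
  simp only [hx, Finset.sum_const, Finset.card_powerset, nsmul_eq_mul] at key
  push_cast at key
  rw [Real.mul_rpow (by positivity) (by positivity)] at key
  have h2 : R ^ r ≤ (khinchineConst r ^ (1 / r) * Q * C) ^ r := by
    refine le_of_mul_le_mul_left (key.trans_eq ?_) hcard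
    have hroot : ((2 ^ s.card : ℝ) ^ (1 / r)) ^ r = 2 ^ s.card := by
      rw [one_div, Real.rpow_inv_rpow hcard.le hr.ne']
    nth_rw 2 [← hroot]
    rw [Real.mul_rpow (x := 2 ^ s.card) hcard.le hK.le, ← Real.mul_rpow C.coe_nonneg (by positivity),
      ← Real.mul_rpow (z := r) (x := (2 ^ s.card : ℝ) ^ (1 / r)) (by positivity) (by positivity)]
    congr 1
    ring
  exact (Real.rpow_le_rpow_iff hR0 (by positivity) hr).1 h2

/-- Averaging the functionals `∑ ± aₙ eₙ*` over all choices of signs. -/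
theorem sum_sqrt_le_of_forall_dual (s : Finset ℕ) (a : ℕ → ℝ) (ha : ∀ n, 0 ≤ a n)
    (hat : ∀ t : ℕ → ℝ, (∀ n, 0 ≤ t n) →
      ∑ n ∈ s, a n * t n ≤ (∑ n ∈ s, t n ^ (p : ℝ)) ^ (1 / (p : ℝ)))
    {ι : Type*} [Fintype ι] (x : ι → ℓ^p(ℕ, ℂ)) {W : ℝ}
    (hx : ∀ φ : StrongDual ℂ ℓ^p(ℕ, ℂ), ‖φ‖ ≤ 1 → ∑ j, ‖φ (x j)‖ ≤ W) :
    ∑ j, √(∑ n ∈ s, (a n * ‖x j n‖) ^ 2) ≤ khinchineLowerConst * W := by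
  have hp : (0 : ℝ) < p := zero_lt_one.trans_le (one_le_coe_of_fact p)
  let φ : Finset ℕ → StrongDual ℂ ℓ^p(ℕ, ℂ) := fun A =>
    ∑ n ∈ s, (if n ∈ A then (a n : ℂ) else -a n) • lp.evalCLM ℂ (fun _ : ℕ => ℂ) p n
  have hφ : ∀ A y, φ A y = signedSum s A fun n => a n * y n := fun A y => by
    simp only [φ, signedSum, sum_apply]
    refine Finset.sum_congr rfl fun n _ => ?_
    split_ifs <;> simp [lp.evalCLM]
  have hφ1 : ∀ A, ‖φ A‖ ≤ 1 := fun A => by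
    refine ContinuousLinearMap.opNorm_le_bound _ zero_le_one fun y => ?_
    rw [hφ, one_mul]
    calc ‖signedSum s A fun n => a n * y n‖ ≤ ∑ n ∈ s, a n * ‖y n‖ := by
          refine (norm_sum_le _ _).trans (le_of_eq (Finset.sum_congr rfl fun n _ => ?_))
          split_ifs <;> simp [abs_of_nonneg (ha n)]
      _ ≤ (∑ n ∈ s, ‖y n‖ ^ (p : ℝ)) ^ (1 / (p : ℝ)) := hat _ fun n => norm_nonneg _
      _ ≤ (‖y‖ ^ (p : ℝ)) ^ (1 / (p : ℝ)) := by
          gcongr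
          exact lp.sum_rpow_le_norm_rpow (p := (p : ℝ≥0∞)) (by simpa using hp) y s
      _ = ‖y‖ := by rw [one_div, Real.rpow_rpow_inv (norm_nonneg _) hp.ne']
  have h1 : 2 ^ s.card * ∑ j, √(∑ n ∈ s, (a n * ‖x j n‖) ^ 2) ≤
      2 ^ s.card * (khinchineLowerConst * W) :=
    calc _ = ∑ j, 2 ^ s.card * √(∑ n ∈ s, ‖(a n : ℂ) * x j n‖ ^ 2) := by
          simp only [Finset.mul_sum, norm_mul, Complex.norm_real, Real.norm_of_nonneg (ha _)]
      _ ≤ ∑ j, khinchineLowerConst * ∑ A ∈ s.powerset, ‖φ A (x j)‖ := by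
          simp only [hφ]
          exact Finset.sum_le_sum fun j _ => sqrt_sum_sq_le_sum_norm_signedSum s _
      _ = khinchineLowerConst * ∑ A ∈ s.powerset, ∑ j, ‖φ A (x j)‖ := by
          rw [← Finset.mul_sum, Finset.sum_comm]
      _ ≤ khinchineLowerConst * ∑ A ∈ s.powerset, W := by
          have := khinchineLowerConst_pos
          gcongr with A
          exact hx _ (hφ1 A)
      _ = _ := by
          rw [Finset.sum_const, Finset.card_powerset, nsmul_eq_mul]
          push_cast
          ring
  exact le_of_mul_le_mul_left h1 (by positivity)

theorem isSummingConstant_multiplier_of_forall {r : ℝ} (hr : 0 < r) {β : ℓ^∞(ℕ, ℂ)} {C : ℝ≥0}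
    (h : ∀ (s : Finset ℕ) (n : ℕ) (x : Fin n → ℓ^p(ℕ, ℂ)) (W : ℝ), 0 ≤ W →
      (∀ φ : StrongDual ℂ ℓ^p(ℕ, ℂ), ‖φ‖ ≤ 1 → ∑ j, ‖φ (x j)‖ ^ r ≤ W ^ r) →
      ∑ j, ((∑ n ∈ s, (‖β n‖ * ‖x j n‖) ^ (p : ℝ)) ^ (1 / (p : ℝ))) ^ r ≤ (C * W) ^ r) :
    IsSummingConstant r (multiplier p β) C := by
  refine isSummingConstant_of_forall hr fun n x W hW hx => ?_
  -- Finite truncations of `multiplier p β (x j)` converge in norm since `p < ∞`, so bounds uniform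
  -- in `s` pass to the limit.
  have hlim : Filter.Tendsto (fun s : Finset ℕ =>
      ∑ j, ‖∑ n ∈ s, (lp.single p n (multiplier p β (x j) n) : ℓ^p(ℕ, ℂ))‖ ^ r) Filter.atTop
      (nhds (∑ j, ‖multiplier p β (x j)‖ ^ r)) :=
    tendsto_finsetSum _ fun j _ =>
      ((lp.hasSum_single ENNReal.coe_ne_top (multiplier p β (x j))).norm).rpow_const
        (Or.inr hr.le)
  refine le_of_tendsto' hlim fun s => ?_
  simp only [norm_sum_single_eq, multiplier_apply, norm_mul]
  exact h s n x W hW hx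

end Lp

/-! ### Hölder-type inequalities for finite sequences. -/

theorem sum_rpow_rpow_inv_anti {ι : Type*} (s : Finset ι) {y : ι → ℝ} (hy : ∀ i ∈ s, 0 ≤ y i)
    {q r : ℝ} (hr : 0 < r) (hrq : r ≤ q) :
    (∑ i ∈ s, y i ^ q) ^ (1 / q) ≤ (∑ i ∈ s, y i ^ r) ^ (1 / r) := by
  have hq : 0 < q := hr.trans_le hrq
  have h0 : 0 ≤ ∑ i ∈ s, y i ^ r := Finset.sum_nonneg fun i hi => Real.rpow_nonneg (hy i hi) r
  have h := sum_rpow_le_rpow_sum s (u := fun i => y i ^ r)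
    (fun i hi => Real.rpow_nonneg (hy i hi) r) ((one_le_div hr).2 hrq)
  have e : ∀ i ∈ s, (y i ^ r) ^ (q / r) = y i ^ q := fun i hi => by
    rw [← Real.rpow_mul (hy i hi), mul_div_cancel₀ _ hr.ne']
  rw [Finset.sum_congr rfl e] at h
  calc _ ≤ ((∑ i ∈ s, y i ^ r) ^ (q / r)) ^ (1 / q) :=
        Real.rpow_le_rpow (Finset.sum_nonneg fun i hi => Real.rpow_nonneg (hy i hi) q) h
          (by positivity)
    _ = _ := by rw [← Real.rpow_mul h0]; congr 1; field_simp

/-- Hölder with weights `1 - q/2` and `q/2`: the multiplier `b^(2/q-1)` maps `ℓ²` to `ℓ^q`. Both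
bounds for `p ≤ 2` rest on it. -/
theorem sum_rpow_mul_rpow_inv_le {ι : Type*} (s : Finset ι) {b y : ι → ℝ} (hb : ∀ i, 0 ≤ b i)
    (hy : ∀ i, 0 ≤ y i) {q : ℝ} (hq : 0 < q) (hq2 : q ≤ 2) :
    (∑ i ∈ s, (b i ^ (2 / q - 1) * y i) ^ q) ^ (1 / q) ≤
      (∑ i ∈ s, b i ^ (2 : ℝ)) ^ (1 / q - 1 / 2) * √(∑ i ∈ s, y i ^ 2) := by
  have hB : 0 ≤ ∑ i ∈ s, b i ^ (2 : ℝ) := Finset.sum_nonneg fun i _ => Real.rpow_nonneg (hb i) _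
  have hY : 0 ≤ ∑ i ∈ s, y i ^ 2 := Finset.sum_nonneg fun i _ => sq_nonneg _
  have e : ∀ i, (b i ^ (2 / q - 1) * y i) ^ q =
      (b i ^ (2 : ℝ)) ^ (1 - q / 2) * (y i ^ 2) ^ (q / 2) := fun i => by
    rw [Real.mul_rpow (Real.rpow_nonneg (hb i) _) (hy i), ← Real.rpow_mul (hb i),
      ← Real.rpow_mul (hb i), ← Real.rpow_natCast, ← Real.rpow_mul (hy i)]
    congr 2
    · field_simp
    · push_cast; ring
  simp only [e]
  have h := sum_rpow_mul_rpow_le s (u := fun i => b i ^ (2 : ℝ)) (v := fun i => y i ^ 2)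
    (fun i _ => Real.rpow_nonneg (hb i) _) (fun i _ => sq_nonneg _) (a := 1 - q / 2) (b := q / 2)
    (by linarith) (by linarith) (by ring)
  calc _ ≤ _ := Real.rpow_le_rpow (Finset.sum_nonneg fun i _ => mul_nonneg
        (Real.rpow_nonneg (Real.rpow_nonneg (hb i) _) _) (Real.rpow_nonneg (sq_nonneg _) _)) h
        (by positivity)
    _ = _ := by
      rw [Real.mul_rpow (by positivity) (by positivity), ← Real.rpow_mul hB, ← Real.rpow_mul hY,
        Real.sqrt_eq_rpow]
      congr 2 <;> field_simp

theorem sum_mul_rpow_le_of_sum_le_one {ι : Type*} (s : Finset ι) {b t : ι → ℝ}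
    (hb : ∀ i, 0 ≤ b i) (ht : ∀ i, 0 ≤ t i) {p q : ℝ} (hp : 1 ≤ p)
    (h : ∑ i ∈ s, b i ^ q ≤ 1) :
    ∑ i ∈ s, b i ^ (q * (1 - 1 / p)) * t i ≤ (∑ i ∈ s, t i ^ p) ^ (1 / p) := by
  have hp0 : 0 < p := by linarith
  have hθ : 0 ≤ 1 - 1 / p := sub_nonneg.2 ((div_le_one hp0).2 hp)
  have e : ∀ i, b i ^ (q * (1 - 1 / p)) * t i = (b i ^ q) ^ (1 - 1 / p) * (t i ^ p) ^ (1 / p) :=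
    fun i => by rw [← Real.rpow_mul (hb i), one_div p, Real.rpow_rpow_inv (ht i) hp0.ne']
  simp only [e]
  refine (sum_rpow_mul_rpow_le s (fun i _ => Real.rpow_nonneg (hb i) _)
    (fun i _ => Real.rpow_nonneg (ht i) _) hθ (by positivity) (by ring)).trans ?_
  exact mul_le_of_le_one_left
    (Real.rpow_nonneg (Finset.sum_nonneg fun i _ => Real.rpow_nonneg (ht i) _) _)
    (Real.rpow_le_one (Finset.sum_nonneg fun i _ => Real.rpow_nonneg (hb i) _) h hθ)

/-- The extremal choice `t = c^(q-1)` gives `S ≤ S^(1/p)` for `S = ∑ c^q`, which excludes `S > 1`.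
-/
theorem sum_rpow_conj_le_one {s : Finset ℕ} {c : ℕ → ℝ} (hc : ∀ n, 0 ≤ c n) {p q : ℝ}
    (hpq : p.HolderConjugate q)
    (h : ∀ t : ℕ → ℝ, (∀ n, 0 ≤ t n) → ∑ n ∈ s, c n * t n ≤ (∑ n ∈ s, t n ^ p) ^ (1 / p)) :
    ∑ n ∈ s, c n ^ q ≤ 1 := by
  have h1 := h (fun n => c n ^ (q - 1)) fun n => Real.rpow_nonneg (hc n) _
  have e1 : ∀ n, c n * c n ^ (q - 1) = c n ^ q := fun n => by
    rw [← Real.rpow_one_add' (hc n) (by rw [add_sub_cancel]; exact hpq.symm.ne_zero),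
      add_sub_cancel]
  have e2 : ∀ n, (c n ^ (q - 1)) ^ p = c n ^ q := fun n => by
    rw [← Real.rpow_mul (hc n), hpq.symm.sub_one_mul_conj]
  simp only [e1, e2] at h1
  by_contra! hlt
  have := Real.rpow_lt_rpow_of_exponent_lt hlt ((div_lt_one hpq.pos).2 hpq.lt)
  rw [Real.rpow_one] at this
  linarith

/-! ### Bounds for multipliers. -/

section Lp

variable {p : ℝ≥0} [Fact (1 ≤ (p : ℝ≥0∞))] {β : ℓ^∞(ℕ, ℂ)} {C D : ℝ≥0} {r : ℝ}

theorem norm_evalCLM_le_one (n : ℕ) :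
    ‖(lp.evalCLM ℂ (fun _ : ℕ => ℂ) (p : ℝ≥0∞) n)‖ ≤ 1 := by
  refine ContinuousLinearMap.opNorm_le_bound _ zero_le_one fun y => ?_
  rw [one_mul]
  exact lp.norm_apply_le_norm (zero_lt_one.trans_le Fact.out).ne' y n

/-- The unit vectors are weakly `q`-summable with norm at most 1, hence weakly `r`-summable with
norm at most 1 for `r ≥ q`. -/
theorem IsSummingConstant.sum_rpow_le_of_conj_le {q : ℝ} (hpq : (p : ℝ).HolderConjugate q)
    (hqr : q ≤ r) (h : IsSummingConstant r (multiplier p β) C) (s : Finset ℕ) :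
    ∑ n ∈ s, ‖β n‖ ^ r ≤ (C : ℝ) ^ r := by
  have hr : 0 < r := hpq.symm.pos.trans_le hqr
  have hp : (0 : ℝ≥0∞) < p := zero_lt_one.trans_le Fact.out
  have key := h.sum_norm_rpow_le hr (fun n : s => (lp.single p (n : ℕ) (1 : ℂ) : ℓ^p(ℕ, ℂ)))
    zero_le_one fun φ hφ => by
      rw [Finset.sum_coe_sort s fun n => ‖φ (lp.single p n 1)‖ ^ r, Real.one_rpow]
      have h1 := sum_rpow_conj_le_one (fun n => norm_nonneg (φ (lp.single p n 1))) hpq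
        (sum_norm_dual_mul_le φ hφ s)
      have h2 := sum_rpow_rpow_inv_anti s (fun n _ => norm_nonneg (φ (lp.single p n 1)))
        hpq.symm.pos hqr
      have h3 := h2.trans (Real.rpow_le_one (by positivity) h1 (one_div_nonneg.2 hpq.symm.nonneg))
      rwa [one_div, Real.rpow_inv_le_iff_of_pos (by positivity) zero_le_one hr,
        Real.one_rpow] at h3
  simp only [multiplier_single, norm_smul, lp.norm_single hp, norm_one, mul_one] at key
  rwa [Finset.sum_coe_sort s fun n => ‖β n‖ ^ r] at key

theorem isSummingConstant_multiplier_of_le (hr : 0 < r) (hrp : r ≤ p)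
    (hD : ∀ s : Finset ℕ, ∑ n ∈ s, ‖β n‖ ^ r ≤ (D : ℝ) ^ r) :
    IsSummingConstant r (multiplier p β) D := by
  refine isSummingConstant_multiplier_of_forall hr fun s n x W hW hx => ?_
  calc ∑ j, ((∑ n ∈ s, (‖β n‖ * ‖x j n‖) ^ (p : ℝ)) ^ (1 / (p : ℝ))) ^ r
      ≤ ∑ j, ∑ n ∈ s, ‖β n‖ ^ r * ‖x j n‖ ^ r := by
        refine Finset.sum_le_sum fun j _ => ?_
        have h := sum_rpow_rpow_inv_anti s (y := fun n => ‖β n‖ * ‖x j n‖)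
          (fun n _ => by positivity) hr hrp
        refine (Real.rpow_le_rpow (by positivity) h hr.le).trans_eq ?_
        rw [one_div, Real.rpow_inv_rpow (by positivity) hr.ne']
        exact Finset.sum_congr rfl fun n _ => Real.mul_rpow (norm_nonneg _) (norm_nonneg _)
    _ = ∑ n ∈ s, ‖β n‖ ^ r * ∑ j, ‖x j n‖ ^ r := by
        rw [Finset.sum_comm]; simp only [Finset.mul_sum]
    _ ≤ ∑ n ∈ s, ‖β n‖ ^ r * W ^ r := by
        gcongr with n
        exact hx _ (norm_evalCLM_le_one n)
    _ ≤ (D : ℝ) ^ r * W ^ r := by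
        rw [← Finset.sum_mul]
        gcongr
        exact hD s
    _ = _ := (Real.mul_rpow D.coe_nonneg hW).symm

/-- Reduction of an upper bound for the summing norm to a normalized estimate for `r = 1`. -/
theorem isSummingConstant_multiplier_of_normalized {q : ℝ} (hq : 0 < q) {K : ℝ≥0}
    (h : ∀ (s : Finset ℕ) (b : ℕ → ℝ), (∀ n, 0 ≤ b n) → ∑ n ∈ s, b n ^ q ≤ 1 →
      ∀ (n : ℕ) (x : Fin n → ℓ^p(ℕ, ℂ)) (W : ℝ),
        (∀ φ : StrongDual ℂ ℓ^p(ℕ, ℂ), ‖φ‖ ≤ 1 → ∑ j, ‖φ (x j)‖ ≤ W) →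
        ∑ j, (∑ n ∈ s, (b n * ‖x j n‖) ^ (p : ℝ)) ^ (1 / (p : ℝ)) ≤ K * W)
    (hr : 1 ≤ r) (hD : ∀ s : Finset ℕ, ∑ n ∈ s, ‖β n‖ ^ q ≤ (D : ℝ) ^ q) :
    IsSummingConstant r (multiplier p β) (K * D) := by
  have hp : (0 : ℝ) < p := zero_lt_one.trans_le (one_le_coe_of_fact p)
  refine IsSummingConstant.mono_exponent ?_ zero_lt_one hr
  refine isSummingConstant_multiplier_of_forall zero_lt_one fun s n x W hW hx => ?_
  simp only [Real.rpow_one] at hx ⊢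
  -- When `D = 0`, the singleton case of `hD` forces `β n = 0`, so the identity survives division by
  -- zero.
  have h1 : ∀ n, ‖β n‖ = D * (‖β n‖ / D) := fun n => by
    rcases eq_or_ne D 0 with rfl | hD0
    · have := hD {n}
      rw [Finset.sum_singleton, Real.rpow_le_rpow_iff (norm_nonneg _) (by simp) hq] at this
      simpa using this
    · rw [mul_div_cancel₀]
      exact_mod_cast hD0
  have h2 : ∑ n ∈ s, (‖β n‖ / D) ^ q ≤ 1 := by
    simp only [Real.div_rpow (norm_nonneg _) D.coe_nonneg, ← Finset.sum_div]
    exact div_le_one_of_le₀ (hD s) (by positivity)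
  have h3 := h s (fun n => ‖β n‖ / D) (fun n => by positivity) h2 n x W hx
  have e : ∀ j, (∑ n ∈ s, (‖β n‖ * ‖x j n‖) ^ (p : ℝ)) ^ (1 / (p : ℝ)) =
      D * (∑ n ∈ s, (‖β n‖ / D * ‖x j n‖) ^ (p : ℝ)) ^ (1 / (p : ℝ)) := fun j => by
    have : ∀ n, (‖β n‖ * ‖x j n‖) ^ (p : ℝ) =
        (D : ℝ) ^ (p : ℝ) * (‖β n‖ / D * ‖x j n‖) ^ (p : ℝ) := fun n => by
      rw [← Real.mul_rpow (by positivity) (by positivity), ← mul_assoc, ← h1]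
    simp only [this, ← Finset.mul_sum]
    rw [Real.mul_rpow (by positivity) (by positivity), one_div,
      Real.rpow_rpow_inv D.coe_nonneg hp.ne']
  simp only [e, ← Finset.mul_sum]
  push_cast
  calc _ ≤ (D : ℝ) * (K * W) := by gcongr
    _ = _ := by ring

/-- Split `b = b^(2/p-1) · b^(2(1-1/p))`: the second factor lies in the dual ball and enters the
sign average, the first passes from `ℓ²` to `ℓ^p`. -/
theorem isSummingConstant_multiplier_of_le_two (hp2 : (p : ℝ) ≤ 2) (hr : 1 ≤ r)
    (hD : ∀ s : Finset ℕ, ∑ n ∈ s, ‖β n‖ ^ (2 : ℝ) ≤ (D : ℝ) ^ (2 : ℝ)) :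
    IsSummingConstant r (multiplier p β) (khinchineLowerConst.toNNReal * D) := by
  have hp1 := one_le_coe_of_fact p
  have hp : (0 : ℝ) < p := zero_lt_one.trans_le hp1
  refine isSummingConstant_multiplier_of_normalized two_pos (fun s b hb hb1 n x W hx => ?_) hr hD
  rw [Real.coe_toNNReal _ khinchineLowerConst_pos.le]
  refine le_trans (Finset.sum_le_sum fun j _ => ?_) (sum_sqrt_le_of_forall_dual s
    (fun n => b n ^ (2 * (1 - 1 / (p : ℝ)))) (fun n => Real.rpow_nonneg (hb n) _)
    (fun t ht => sum_mul_rpow_le_of_sum_le_one s hb ht hp1 hb1) x hx)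
  have h := sum_rpow_mul_rpow_inv_le s hb
    (fun n => mul_nonneg (Real.rpow_nonneg (hb n) (2 * (1 - 1 / (p : ℝ)))) (norm_nonneg (x j n)))
    hp hp2
  have e : ∀ n, b n ^ (2 / (p : ℝ) - 1) * (b n ^ (2 * (1 - 1 / (p : ℝ))) * ‖x j n‖) =
      b n * ‖x j n‖ := fun n => by
    have h1 : 2 / (p : ℝ) - 1 + 2 * (1 - 1 / (p : ℝ)) = 1 := by ring
    rw [← mul_assoc, ← Real.rpow_add' (hb n) (by rw [h1]; exact one_ne_zero), h1, Real.rpow_one]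
  simp only [e] at h
  refine h.trans (mul_le_of_le_one_left (Real.sqrt_nonneg _) (Real.rpow_le_one
    (Finset.sum_nonneg fun i _ => Real.rpow_nonneg (hb i) _) hb1 ?_))
  rw [sub_nonneg]
  exact one_div_le_one_div_of_le hp hp2

theorem isSummingConstant_multiplier_of_two_le {q : ℝ} (hpq : (p : ℝ).HolderConjugate q)
    (hp2 : 2 ≤ (p : ℝ)) (hr : 1 ≤ r)
    (hD : ∀ s : Finset ℕ, ∑ n ∈ s, ‖β n‖ ^ q ≤ (D : ℝ) ^ q) :
    IsSummingConstant r (multiplier p β) (khinchineLowerConst.toNNReal * D) := by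
  refine isSummingConstant_multiplier_of_normalized hpq.symm.pos (fun s b hb hb1 n x W hx => ?_)
    hr hD
  rw [Real.coe_toNNReal _ khinchineLowerConst_pos.le]
  refine le_trans (Finset.sum_le_sum fun j _ => ?_) (sum_sqrt_le_of_forall_dual s
    b hb (fun t ht => ?_) x hx)
  · have h := sum_rpow_rpow_inv_anti s (y := fun n => b n * ‖x j n‖)
      (fun n _ => mul_nonneg (hb n) (norm_nonneg _)) two_pos hp2
    rw [← Real.sqrt_eq_rpow] at h
    simpa only [Real.rpow_two] using h
  · have h := sum_mul_rpow_le_of_sum_le_one s hb ht hpq.lt.le hb1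
    have e : q * (1 - 1 / (p : ℝ)) = 1 := by
      rw [one_div, hpq.one_sub_inv, mul_inv_cancel₀ hpq.symm.ne_zero]
    simpa only [e, Real.rpow_one] using h

theorem le_sq_of_le_mul_sqrt {X Q : ℝ} (hX : 0 ≤ X) (h : X ≤ Q * √X) : X ≤ Q ^ 2 := by
  have h1 := Real.sq_sqrt hX
  rcases (Real.sqrt_nonneg X).eq_or_lt with h0 | h0
  · rw [← h1, ← h0]; nlinarith [sq_nonneg Q]
  · have : √X ≤ Q := le_of_mul_le_mul_right (by nlinarith) h0
    rw [← h1]; gcongr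

theorem IsSummingConstant.sum_sq_le (hp2 : (p : ℝ) ≤ 2) (hr : 0 < r)
    (h : IsSummingConstant r (multiplier p β) C) (s : Finset ℕ) :
    ∑ n ∈ s, ‖β n‖ ^ (2 : ℝ) ≤ (khinchineConst r ^ (1 / r) * C) ^ (2 : ℝ) := by
  have hp : (0 : ℝ) < p := zero_lt_one.trans_le (one_le_coe_of_fact p)
  have hK := khinchineConst_pos hr
  set B := ∑ n ∈ s, ‖β n‖ ^ (2 : ℝ) with hB
  have hB0 : 0 ≤ B := by positivity
  rcases hB0.eq_or_lt with h0 | hBpos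
  · rw [← h0]; positivity
  have key := h.norm_multiplier_le hr s (fun n => ‖β n‖ ^ (2 / (p : ℝ) - 1))
    (fun n => by positivity) (Q := B ^ (1 / (p : ℝ) - 1 / 2)) (by positivity) fun c hc hct => by
      set a : ℕ → ℝ := fun n => ‖β n‖ ^ (2 / (p : ℝ) - 1)
      have ha : ∀ n, 0 ≤ a n := fun n => by positivity
      -- With `t = a² c` the pairing is exactly `∑ (a c)²`; it is then bounded by `Q` times its own
      -- square root.
      have h1 := hct (fun n => a n * (a n * c n)) fun n =>
        mul_nonneg (ha n) (mul_nonneg (ha n) (hc n))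
      have h2 := h1.trans (sum_rpow_mul_rpow_inv_le s (fun n => norm_nonneg (β n))
        (fun n => mul_nonneg (ha n) (hc n)) hp hp2)
      have e : ∀ n, c n * (a n * (a n * c n)) = (a n * c n) ^ 2 := fun n => by ring
      simp only [e] at h2
      exact le_sq_of_le_mul_sqrt (Finset.sum_nonneg fun n _ => sq_nonneg _) h2
  have e : ∀ n, (‖β n‖ * ‖β n‖ ^ (2 / (p : ℝ) - 1)) ^ (p : ℝ) = ‖β n‖ ^ (2 : ℝ) := fun n => by
    rw [← Real.rpow_one_add' (norm_nonneg _) (by rw [add_sub_cancel]; positivity),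
      add_sub_cancel, ← Real.rpow_mul (norm_nonneg _), div_mul_cancel₀ _ hp.ne']
  simp only [e, ← hB] at key
  have e2 : B ^ (1 / (p : ℝ)) = B ^ (1 / (p : ℝ) - 1 / 2) * B ^ (1 / 2 : ℝ) := by
    rw [← Real.rpow_add hBpos, sub_add_cancel]
  rw [e2, mul_right_comm, mul_comm] at key
  have h3 := le_of_mul_le_mul_right key (by positivity)
  calc B = (B ^ (1 / 2 : ℝ)) ^ (2 : ℝ) := by rw [← Real.rpow_mul hB0]; norm_num
    _ ≤ _ := by gcongr

theorem IsSummingConstant.sum_rpow_le_of_two_le (hp2 : 2 ≤ (p : ℝ)) (hr : 0 < r)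
    (h : IsSummingConstant r (multiplier p β) C) (s : Finset ℕ) :
    ∑ n ∈ s, ‖β n‖ ^ (p : ℝ) ≤ (khinchineConst r ^ (1 / r) * C) ^ (p : ℝ) := by
  have hp : (0 : ℝ) < p := by linarith
  have hK := khinchineConst_pos hr
  have key := h.norm_multiplier_le hr s (fun _ => 1) (fun _ => zero_le_one) zero_le_one
    fun c hc hct => by
      -- Testing with `t = c` gives `‖c‖₂² ≤ ‖c‖_p ≤ ‖c‖₂`, hence `‖c‖₂ ≤ 1`.
      have h1 := (hct c hc).trans (sum_rpow_rpow_inv_anti s (fun n _ => hc n) two_pos hp2)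
      rw [← Real.sqrt_eq_rpow, ← one_mul √_] at h1
      simp only [Real.rpow_two, ← sq] at h1
      simp only [one_mul]
      exact le_sq_of_le_mul_sqrt (Finset.sum_nonneg fun n _ => sq_nonneg _)
        (by simpa only [one_mul] using h1)
  simp only [mul_one] at key
  rwa [one_div, Real.rpow_inv_le_iff_of_pos (by positivity) (by positivity) hp] at key

end Lp

theorem mainTheorem5 (p : ℝ≥0) [Fact (1 ≤ (p : ℝ≥0∞))] (r : ℝ) (hr : 1 ≤ r) :
    ((p : ℝ) ≤ 2 →
      ∃ c c' : ℝ≥0, 0 < c ∧ 0 < c' ∧ ∀ β : ℓ^∞(ℕ, ℂ),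
        c * seqNorm 2 β ≤ summingNorm r (multiplier p β) ∧
        summingNorm r (multiplier p β) ≤ c' * seqNorm 2 β) ∧
    (2 ≤ (p : ℝ) → r ≤ (p : ℝ).conjExponent →
      ∃ c c' : ℝ≥0, 0 < c ∧ 0 < c' ∧ ∀ β : ℓ^∞(ℕ, ℂ),
        c * seqNorm (p : ℝ).conjExponent β ≤ summingNorm r (multiplier p β) ∧
        summingNorm r (multiplier p β) ≤ c' * seqNorm (p : ℝ).conjExponent β) ∧
    (2 ≤ (p : ℝ) → (p : ℝ).conjExponent ≤ r → r ≤ p →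
      ∀ β : ℓ^∞(ℕ, ℂ), summingNorm r (multiplier p β) = seqNorm r β) ∧
    (2 ≤ (p : ℝ) → (p : ℝ) ≤ r →
      ∃ c c' : ℝ≥0, 0 < c ∧ 0 < c' ∧ ∀ β : ℓ^∞(ℕ, ℂ),
        c * seqNorm p β ≤ summingNorm r (multiplier p β) ∧
        summingNorm r (multiplier p β) ≤ c' * seqNorm p β) := by
  have hr0 : 0 < r := zero_lt_one.trans_le hr
  have hK := Real.rpow_pos_of_pos (khinchineConst_pos hr0) (1 / r)
  have hK' : 0 < (khinchineConst r ^ (1 / r)).toNNReal := Real.toNNReal_pos.2 hK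
  have hL : 0 < khinchineLowerConst.toNNReal := Real.toNNReal_pos.2 khinchineLowerConst_pos
  have hconj : 2 ≤ (p : ℝ) → (p : ℝ).HolderConjugate (p : ℝ).conjExponent := fun hp2 =>
    Real.HolderConjugate.conjExponent (by linarith)
  refine ⟨fun hp2 => ⟨_, _, inv_pos.2 hK', hL, fun β => ⟨?_, ?_⟩⟩,
    fun hp2 hrp => ⟨1⁻¹, _, inv_pos.2 one_pos, hL, fun β => ⟨?_, ?_⟩⟩,
    fun hp2 hpr hrp β => le_antisymm ?_ ?_,
    fun hp2 hpr => ⟨_, 1, inv_pos.2 hK', one_pos, fun β => ⟨?_, ?_⟩⟩⟩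
  · refine inv_mul_seqNorm_le_summingNorm two_pos hK' fun C hC s => ?_
    rw [NNReal.coe_mul, Real.coe_toNNReal _ hK.le]
    exact hC.sum_sq_le hp2 hr0 s
  · exact summingNorm_le_mul_seqNorm two_pos hL fun D hD =>
      isSummingConstant_multiplier_of_le_two hp2 hr hD
  · refine inv_mul_seqNorm_le_summingNorm (hconj hp2).symm.pos one_pos fun C hC s => ?_
    rw [one_mul]
    -- Raising the exponent from `r` to `p'` makes the unit vectors admissible test vectors.
    exact (hC.mono_exponent hr0 hrp).sum_rpow_le_of_conj_le (hconj hp2) le_rfl s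
  · exact summingNorm_le_mul_seqNorm (hconj hp2).symm.pos hL fun D hD =>
      isSummingConstant_multiplier_of_two_le (hconj hp2) hp2 hr hD
  · have := summingNorm_le_mul_seqNorm (p := p) (β := β) hr0 one_pos fun D hD => by
      rw [one_mul]
      exact isSummingConstant_multiplier_of_le hr0 hrp hD
    rwa [ENNReal.coe_one, one_mul] at this
  · have := inv_mul_seqNorm_le_summingNorm (p := p) (β := β) hr0 one_pos fun C hC s => by
      rw [one_mul]
      exact hC.sum_rpow_le_of_conj_le (hconj hp2) hpr s
    rwa [inv_one, ENNReal.coe_one, one_mul] at this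
  · refine inv_mul_seqNorm_le_summingNorm (by linarith) hK' fun C hC s => ?_
    rw [NNReal.coe_mul, Real.coe_toNNReal _ hK.le]
    exact hC.sum_rpow_le_of_two_le hp2 hr0 s
  · have hp0 : (0 : ℝ) < p := by linarith
    refine summingNorm_le_mul_seqNorm hp0 one_pos fun D hD => ?_
    rw [one_mul]
    exact (isSummingConstant_multiplier_of_le hp0 le_rfl hD).mono_exponent hp0 hpr
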